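/- Let $\mathbb K$ be a field of characteristic $0$ and $n \ge 0$ an integer. A partition is a non-increasing sequence $\lambda=(\lambda_1,\lambda_2,\dots)$ of non-negative integers with finite sum $|\lambda|$ (parts beyond the length being $0$); a bipartition of $n$ is a pair $(\lambda,\mu)$ of partitions with $|\lambda|+|\mu|=n$. For bipartitions of $n$, $(\lambda,\mu)$ *bidominates* $(\vartheta,\omega)$, written $(\vartheta,\omega)\unlhd(\lambda,\mu)$, if for every integer $k\ge 1$ $$\sum_{j=1}^{k}(\vartheta_j+\omega_j)\le\sum_{j=1}^{k}(\lambda_j+\mu_j)\quad\text{and}\quad \sum_{j=1}^{k-1}(\vartheta_j+\omega_j)+\vartheta_k\le\sum_{j=1}^{k-1}(\lambda_j+\mu_j)+\lambda_k ;$$ this is a partial order on the bipartitions of $n$, the bidominance order. A bitableau $(T,S)$ of shape $(\lambda,\mu)$ is a filling of the boxes of the Young diagrams of $\lambda$ and $\mu$ with the numbers $1,\dots,n$, each used exactly once. For a sequence $(i_1,\dots,i_m)$ of indices put $\Delta_{(i_1,\dots,i_m)}(x^2)=\prod_{1\le a<b\le m}(x_{i_a}^2-x_{i_b}^2)$. With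 $T_1,T_2,\dots$ and $S_1,S_2,\dots$ the columns of $T$ and $S$ read from top to bottom, the $B_n$-Specht polynomial of $(T,S)$ is $$\mathrm{sp}_{(T,S)}=\prod_{i}\Delta_{T_i}(x^2)\,\prod_{j}\Delta_{S_j}(x^2)\,\prod_{k\in S}x_k\in\mathbb K[x_1,\dots,x_n].$$ The $B_n$-Specht ideal $I_{(\lambda,\mu)}\subseteq\mathbb K[x_1,\dots,x_n]$ is the ideal generated by the polynomials $\mathrm{sp}_{(T,S)}$ of all bitableaux $(T,S)$ of shape $(\lambda,\mu)$, and the $B_n$-Specht variety $V_{(\lambda,\mu)}\subseteq\mathbb K^n$ is the set of common zeros in $\mathbb K^n$ of all elements of $I_{(\lambda,\mu)}$. **Theorem.** Let $(\lambda,\mu)$ and $(\vartheta,\omega)$ be bipartitions of $n$. The following are equivalent: 1. $(\lambda,\mu)$ bidominates $(\vartheta,\omega)$; 2. $I_{(\lambda,\mu)}\supseteq I_{(\vartheta,\omega)}$; 3. $V_{(\lambda,\mu)}\subseteq V_{(\vartheta,\omega)}$. So the bidominance order on the bipartitions of $n$ describes exactly the inclusion poset of the $B_n$-Specht ideals and of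 the $B_n$-Specht varieties. -/

import Mathlib

open scoped BigOperators

/-- A bipartition of `n`: a pair of partitions whose sizes add up to `n`. A partition is given by
its Young diagram; its `i`-th part (counted from `0`) is `YoungDiagram.rowLen i`, which is `0`
for all `i` beyond the length. -/
@[ext]
structure Bipartition (n : ℕ) where
  fst : YoungDiagram
  snd : YoungDiagram
  card_add_card : fst.card + snd.card = n

namespace Bipartition

/-- `p` bidominates `q`. With `k = 0, 1, 2, …` counted from `0`, the two conditions are those for
the positive integer `k + 1`. -/
def Bidominates {n : ℕ} (p q : Bipartition n) : Prop :=
  ∀ k : ℕ,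
    (∑ j ∈ Finset.range (k + 1), (q.fst.rowLen j + q.snd.rowLen j) ≤
      ∑ j ∈ Finset.range (k + 1), (p.fst.rowLen j + p.snd.rowLen j)) ∧
    (∑ j ∈ Finset.range k, (q.fst.rowLen j + q.snd.rowLen j) + q.fst.rowLen k ≤
      ∑ j ∈ Finset.range k, (p.fst.rowLen j + p.snd.rowLen j) + p.fst.rowLen k)

theorem Bidominates.antisymm {n : ℕ} {p q : Bipartition n}
    (h₁ : p.Bidominates q) (h₂ : q.Bidominates p) : p = q := by
  have hs : ∀ k, ∑ j ∈ Finset.range k, (q.fst.rowLen j + q.snd.rowLen j) =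
      ∑ j ∈ Finset.range k, (p.fst.rowLen j + p.snd.rowLen j) := by
    intro k
    cases k with
    | zero => simp
    | succ k => exact le_antisymm (h₁ k).1 (h₂ k).1
  have hf : ∀ k, q.fst.rowLen k = p.fst.rowLen k := by
    intro k
    have a := (h₁ k).2
    have b := (h₂ k).2
    have c := hs k
    omega
  have hg : ∀ k, q.snd.rowLen k = p.snd.rowLen k := by
    intro k
    have a := hs (k + 1)
    rw [Finset.sum_range_succ, Finset.sum_range_succ] at a
    have b := hs k
    have c := hf k
    omega
  have key : ∀ μ ν : YoungDiagram, (∀ k, ν.rowLen k = μ.rowLen k) → μ = ν := by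
    intro μ ν h
    ext ⟨i, j⟩
    rw [YoungDiagram.mem_cells, YoungDiagram.mem_cells, YoungDiagram.mem_iff_lt_rowLen,
      YoungDiagram.mem_iff_lt_rowLen, h i]
  exact Bipartition.ext (key _ _ hf) (key _ _ hg)

/-- The bidominance order: `q ≤ p` means that `p` bidominates `q`. -/
instance instPartialOrder (n : ℕ) : PartialOrder (Bipartition n) where
  le q p := p.Bidominates q
  le_refl _ _ := ⟨le_rfl, le_rfl⟩
  le_trans _ _ _ h₁ h₂ k := ⟨(h₁ k).1.trans (h₂ k).1, (h₁ k).2.trans (h₂ k).2⟩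
  le_antisymm _ _ h₁ h₂ := Bidominates.antisymm h₂ h₁

/-- A bitableau of shape `p`: a filling of the boxes of the two diagrams of `p` with all the
elements of `Fin n`, each used exactly once. -/
def Bitableau {n : ℕ} (p : Bipartition n) : Type :=
  ({c // c ∈ p.fst.cells} ⊕ {c // c ∈ p.snd.cells}) ≃ Fin n

namespace Bitableau

variable {n : ℕ} {p : Bipartition n}

/-- The filling of the first diagram. -/
def left (T : Bitableau p) (c : {c // c ∈ p.fst.cells}) : Fin n :=
  Equiv.toFun T (Sum.inl c)

/-- The filling of the second diagram. -/
def right (T : Bitableau p) (c : {c // c ∈ p.snd.cells}) : Fin n :=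
  Equiv.toFun T (Sum.inr c)

end Bitableau

end Bipartition

namespace Specht

open MvPolynomial

/-- The Vandermonde polynomial of a sequence `i` of indices of variables. -/
noncomputable def vandermonde (K : Type*) [Field K] {n m : ℕ} (i : Fin m → Fin n) :
    MvPolynomial (Fin n) K :=
  ∏ j : Fin m, ∏ k ∈ Finset.Ioi j, (X (i j) - X (i k))

/-- The entries of column `c` (counted from `0`) of a filling `t` of the diagram `μ`, read from
top to bottom. -/
def column {n : ℕ} {μ : YoungDiagram} (t : {x // x ∈ μ.cells} → Fin n) (c : ℕ) :
    Fin (μ.colLen c) → Fin n :=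
  fun r => t ⟨((r : ℕ), c),
    (YoungDiagram.mem_cells ..).mpr (YoungDiagram.mem_iff_lt_colLen.mpr r.isLt)⟩

/-- The polynomial of a filling `t` of the diagram `μ`: the product of the Vandermonde polynomials
of its columns (`μ.rowLen 0` is the number of columns). -/
noncomputable def tableauPoly (K : Type*) [Field K] {n : ℕ} {μ : YoungDiagram}
    (t : {x // x ∈ μ.cells} → Fin n) : MvPolynomial (Fin n) K :=
  ∏ c ∈ Finset.range (μ.rowLen 0), vandermonde K (column t c)

/-- The `B_n` Specht polynomial of a bitableau; `expand 2` substitutes the square of each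
variable for that variable. -/
noncomputable def poly (K : Type*) [Field K] {n : ℕ} {p : Bipartition n}
    (T : p.Bitableau) : MvPolynomial (Fin n) K :=
  expand 2 (tableauPoly K T.left) * expand 2 (tableauPoly K T.right) *
    ∏ c : {c // c ∈ p.snd.cells}, X (T.right c)

/-- The `B_n` Specht ideal of a bipartition. -/
noncomputable def ideal (K : Type*) [Field K] {n : ℕ} (p : Bipartition n) :
    Ideal (MvPolynomial (Fin n) K) :=
  Ideal.span (Set.range fun T : p.Bitableau => poly K T)

/-- The `B_n` Specht variety of a bipartition: the common zeros in `K ^ n` of all elements of the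
Specht ideal. -/
def variety (K : Type*) [Field K] {n : ℕ} (p : Bipartition n) : Set (Fin n → K) :=
  {z | ∀ f ∈ ideal K p, eval z f = 0}

end Specht

/-! Interleave the parts as λ₁, μ₁, λ₂, μ₂, …; bidominance then says that every prefix sum of one
sequence is at most that of the other. Up to sign, a Specht polynomial depends only on which
elements share a column, so bitableaux are replaced by colorings of the variables by columns, and
polynomials are compared up to units.

For 1 → 2, a dominated sequence is raised towards the dominating one by elementary transfers
(`exists_transfer`), each of which moves `m` entries from one column to another. A transfer is
matched by an algebraic fact (`Coloring.poly_mem_of_recolor`): in the squared variables, the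
Vandermonde determinant of a column with `s + m` entries may be written in the basis 1, X, …,
X^(s-1), f, fX, …, fX^(m-1) with f monic of degree `s`. Laplace expansion along the last `m` columns
writes it through products of smaller determinants. If f vanishes at the squares of the entries of
the target column, each term, times the remaining factors, is a multiple of a Specht polynomial with
`m` entries moved.

2 → 3 is formal. For 3 → 1, fix `k` and give the entries of a bitableau of the smaller shape natural
number values determined by their rows, so that exactly the boxes in the first `k` positions have
small values (`Coloring.exists_eval_ne_zero`). Its polynomial is nonzero there. If another Specht
polynomial is nonzero at this point, each of its columns contains distinct values, hence few small
ones; counting the small values compares the `k`-th prefix sums.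

Characteristic 0 makes the factorials in the Laplace expansion units and the squares of distinct
natural numbers distinct. -/

namespace Specht

/-! ### Combinatorics: elementary transfers for interleaved sequences. -/

/-- Let `s` and `p` be finitely supported sequences, each of whose even and odd subsequences is
nonincreasing, such that the prefix sums of `p` dominate those of `s` and `s ≠ p`. Then one can
raise `m` boxes of `s` without exceeding `p`: either a single box from position `j` to a position
`i < j`, or `m` boxes, from the positions `i + 1, i + 3, …, j` to `i, i + 2, …, j - 1`. -/
theorem exists_transfer {s p : ℕ → ℕ} (hs : ∀ k, s (k + 2) ≤ s k) (hp : ∀ k, p (k + 2) ≤ p k)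
    (N : ℕ) (hsN : ∀ k, N ≤ k → s k = 0) (hpN : ∀ k, N ≤ k → p k = 0)
    (hle : ∀ k, ∑ j ∈ Finset.range k, s j ≤ ∑ j ∈ Finset.range k, p j)
    (htot : ∑ j ∈ Finset.range N, s j = ∑ j ∈ Finset.range N, p j) (hne : s ≠ p) :
    ∃ i j m, 1 ≤ m ∧ i < j ∧ (m = 1 ∨ j + 1 = i + 2 * m) ∧ (i < 2 ∨ s i < s (i - 2)) ∧
      s (j + 2) < s j ∧ ∀ k, i < k → k ≤ j → (m = 1 ∨ (k - i) % 2 = 1) →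
        ∑ l ∈ Finset.range k, s l < ∑ l ∈ Finset.range k, p l := by
  obtain ⟨S, hS⟩ : ∃ S : ℕ → ℕ, S = fun k => ∑ j ∈ Finset.range k, s j := ⟨_, rfl⟩
  obtain ⟨P, hP⟩ : ∃ P : ℕ → ℕ, P = fun k => ∑ j ∈ Finset.range k, p j := ⟨_, rfl⟩
  have hS1 : ∀ k, S (k + 1) = S k + s k := fun k => by simp [hS, Finset.sum_range_succ]
  have hP1 : ∀ k, P (k + 1) = P k + p k := fun k => by simp [hP, Finset.sum_range_succ]
  have hSP : ∀ k, S k ≤ P k := fun k => by simpa [hS, hP] using hle k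
  have hSN : ∀ k, S (N + k) = P (N + k) := by
    intro k
    induction k with
    | zero => simpa [hS, hP] using htot
    | succ k ih =>
      rw [← add_assoc, hS1, hP1, ih, hsN _ (by omega), hpN _ (by omega)]
  suffices h : ∃ i j m, 1 ≤ m ∧ i < j ∧ (m = 1 ∨ j + 1 = i + 2 * m) ∧
      (i < 2 ∨ s i < s (i - 2)) ∧ s (j + 2) < s j ∧
      ∀ k, i < k → k ≤ j → (m = 1 ∨ (k - i) % 2 = 1) → S k < P k by
    simpa [hS, hP] using h
  have hS0 : S 0 = P 0 := by simp [hS, hP]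
  clear hS hP hle htot
  -- `i` is the last position where the prefix sums agree, `p` moves ahead and a box can be added to
  -- `s`. The first position where `s` and `p` differ is a candidate.
  obtain ⟨i, ⟨hi0, hi1, hi2⟩, himax⟩ : ∃ i,
      (S i = P i ∧ s i < p i ∧ (i < 2 ∨ s i < s (i - 2))) ∧
      ∀ i', i < i' → ¬ (S i' = P i' ∧ s i' < p i' ∧ (i' < 2 ∨ s i' < s (i' - 2))) := by
    classical
    have hex : ∃ i, S i = P i ∧ s i < p i ∧ (i < 2 ∨ s i < s (i - 2)) := by
      have hd : ∃ i, s i ≠ p i := by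
        by_contra! h
        exact hne (funext h)
      have hlt : ∀ k < Nat.find hd, s k = p k := fun k hk => not_not.1 (Nat.find_min hd hk)
      have heq : ∀ k, k ≤ Nat.find hd → S k = P k := by
        intro k
        induction k with
        | zero => intro _; exact hS0
        | succ k ih => intro hk; rw [hS1, hP1, ih (by omega), hlt k (by omega)]
      have h1 := Nat.find_spec hd
      have h2 := hSP (Nat.find hd + 1)
      rw [hS1, hP1, heq _ le_rfl] at h2
      refine ⟨Nat.find hd, heq _ le_rfl, by omega, ?_⟩
      rcases lt_or_ge (Nat.find hd) 2 with h | h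
      · exact Or.inl h
      · right
        have h3 := hp (Nat.find hd - 2)
        rw [Nat.sub_add_cancel h] at h3
        have h4 := hlt (Nat.find hd - 2) (by omega)
        omega
    obtain ⟨i, hi⟩ := hex
    have hb : ∀ i, (S i = P i ∧ s i < p i ∧ (i < 2 ∨ s i < s (i - 2))) → i ≤ N := by
      intro i hi
      by_contra! h
      have := hpN i h.le
      omega
    refine ⟨Nat.findGreatest (fun i => S i = P i ∧ s i < p i ∧ (i < 2 ∨ s i < s (i - 2))) N,
      Nat.findGreatest_spec (P := fun i => S i = P i ∧ s i < p i ∧ (i < 2 ∨ s i < s (i - 2)))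
        (hb i hi) hi, fun i' h1 h2 => Nat.findGreatest_is_greatest h1 (hb i' h2) h2⟩
  -- `j + 1` is the first place after `i` where the prefix sums agree again. If `j` is removable,
  -- one box can move from `j` to `i`.
  obtain ⟨j, hij, hj, hjmin⟩ : ∃ j, i < j ∧ S (j + 1) = P (j + 1) ∧
      ∀ k, i < k → k ≤ j → S k < P k := by
    have hex : ∃ j, i < j ∧ S (j + 1) = P (j + 1) := by
      refine ⟨N + i + 1, by omega, ?_⟩
      have := hSN (i + 2)
      rwa [show N + (i + 2) = N + i + 1 + 1 by omega] at this
    refine ⟨Nat.find hex, (Nat.find_spec hex).1, (Nat.find_spec hex).2, fun k hk hkj => ?_⟩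
    rcases Nat.lt_or_ge (i + 1) k with h | h
    · have := Nat.find_min hex (m := k - 1) (by omega)
      rw [Nat.sub_add_cancel (by omega)] at this
      have := hSP k
      omega
    · obtain rfl : k = i + 1 := by omega
      rw [hS1, hP1]
      omega
  by_contra hcon
  -- what happens behind a position that is not removable
  have hnext : ∀ j, i < j → S (j + 1) = P (j + 1) → p j < s j → s (j + 2) = s j →
      p (j + 2) ≤ p j ∧ s (j + 1) < p (j + 1) ∧ s (j + 1) = s (j - 1) ∧ p (j + 1) ≤ p (j - 1) ∧
      s (j + 1) + s (j + 2) ≤ p (j + 1) + p (j + 2) := by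
    intro j hij hj hlt heq
    have h1 := hp j
    have h2 := hSP (j + 3)
    rw [hS1, hS1, hP1, hP1] at h2
    -- Since `p (j + 2) ≤ p j < s j = s (j + 2)`, domination at `j + 3` needs a gain at `j + 1`; by
    -- maximality of `i` that position is not addable.
    have h3 : s (j + 1) < p (j + 1) := by omega
    have h4 := himax (j + 1) (by omega)
    have h5 := hs (j - 1)
    have h6 := hp (j - 1)
    rw [show j - 1 + 2 = j + 1 by omega] at h5 h6
    rw [show j + 1 - 2 = j - 1 by omega] at h4
    refine ⟨h1, h3, ?_, h6, by omega⟩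
    by_contra h7
    exact h4 ⟨hj, h3, Or.inr (by omega)⟩
  have hjlt : p j < s j := by
    have h1 := hjmin j hij le_rfl
    rw [hS1, hP1] at hj
    omega
  -- If `j` is not removable, the inequalities of `hnext` squeeze the prefix sums at `j - 1` to
  -- equality, so `j - 1 = i` by minimality of `j`.
  have hji : j = i + 1 ∧ p i + p (i + 1) = s i + s (i + 1) := by
    have hjr : s (j + 2) = s j := by
      by_contra h
      refine hcon ⟨i, j, 1, le_rfl, hij, Or.inl rfl, hi2, lt_of_le_of_ne (hs j) h, ?_⟩
      exact fun k h1 h2 _ => hjmin k h1 h2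
    obtain ⟨h1, h2, h3, h4, h5⟩ := hnext j hij hj hjlt hjr
    obtain ⟨l, rfl⟩ : ∃ l, j = l + 1 := ⟨j - 1, by omega⟩
    have h6 := hSP l
    rw [hS1, hS1, hP1, hP1] at hj
    rw [Nat.add_sub_cancel] at h3 h4
    have h7 : S l = P l := by omega
    have h8 : l = i := by
      by_contra h
      have := hjmin l (by omega) (by omega)
      omega
    subst h8
    exact ⟨rfl, by omega⟩
  obtain ⟨rfl, hsum⟩ := hji
  -- If no pair `i + 2t, i + 2t + 1` ends in a removable position, all inequalities of `hnext` are
  -- equalities and the discrepancy `p i - s i` repeats in every pair. The first removable end would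
  -- give a transfer of `t + 1` boxes.
  have key : ∀ t, ∀ t', t' ≤ t → S (i + 2 * t') = P (i + 2 * t') ∧
      p (i + 2 * t') + s i = s (i + 2 * t') + p i ∧
      s (i + 2 * t' + 1) + s i = p (i + 2 * t' + 1) + p i := by
    intro t
    induction t with
    | zero =>
      intro t' ht'
      obtain rfl : t' = 0 := by omega
      exact ⟨hi0, by simp; omega, by simp; omega⟩
    | succ t ih =>
      intro t' ht'
      rcases Nat.lt_or_ge t' (t + 1) with h | h
      · exact ih t' (by omega)
      obtain rfl : t' = t + 1 := by omega
      obtain ⟨a1, a2, a3⟩ := ih t le_rfl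
      have b1 : S (i + 2 * t + 1 + 1) = P (i + 2 * t + 1 + 1) := by
        rw [hS1, hS1, hP1, hP1]; omega
      have hjr : s (i + 2 * t + 1 + 2) = s (i + 2 * t + 1) := by
        by_contra h
        refine hcon ⟨i, i + 2 * t + 1, t + 1, by omega, by omega, Or.inr (by omega), hi2,
          lt_of_le_of_ne (hs _) h, ?_⟩
        intro k h1 h2 h3
        rcases h3 with h3 | h3
        · obtain rfl : t = 0 := by omega
          exact hjmin k h1 (by omega)
        · obtain ⟨u, rfl⟩ : ∃ u, k = i + 2 * u + 1 := ⟨(k - i) / 2, by omega⟩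
          obtain ⟨c1, c2, c3⟩ := ih u (by omega)
          rw [hS1, hP1]
          omega
      obtain ⟨h1, h2, h3, h4, h5⟩ := hnext (i + 2 * t + 1) (by omega) b1 (by omega) hjr
      rw [Nat.add_sub_cancel] at h3 h4
      have e1 : i + 2 * (t + 1) = i + 2 * t + 1 + 1 := by ring
      rw [e1]
      exact ⟨b1, by omega, by
        rw [show i + 2 * t + 1 + 1 + 1 = i + 2 * t + 1 + 2 by ring]; omega⟩
  -- A positive discrepancy that repeats forever contradicts finite support.
  have h1 := (key N N le_rfl).2.1
  rw [hsN (i + 2 * N) (by omega), hpN (i + 2 * N) (by omega)] at h1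
  omega

end Specht

/-! ### Laplace expansion and Vandermonde determinants. -/

namespace Specht

section Determinants

variable {R : Type*} [CommRing R]

/-- A weak form of the Laplace expansion along a block of columns. -/
theorem det_mul_mem_of_forall_minors {α β : Type*} [Fintype α] [DecidableEq α] [Fintype β]
    [DecidableEq β] (M : Matrix (α ⊕ β) (α ⊕ β) R) (J : Ideal R) (c : R)
    (hu : IsUnit ((Fintype.card (Equiv.Perm α) * Fintype.card (Equiv.Perm β) : ℕ) : R))
    (h : ∀ σ : Equiv.Perm (α ⊕ β),
      (Matrix.of fun a i : α => M (σ (Sum.inl a)) (Sum.inl i)).det *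
        (Matrix.of fun b i : β => M (σ (Sum.inr b)) (Sum.inr i)).det * c ∈ J) :
    M.det * c ∈ J := by
  have key : ∑ σ : Equiv.Perm (α ⊕ β), ((Equiv.Perm.sign σ : ℤ) : R) *
      ((Matrix.of fun a i : α => M (σ (Sum.inl a)) (Sum.inl i)).det *
        (Matrix.of fun b i : β => M (σ (Sum.inr b)) (Sum.inr i)).det) =
      ((Fintype.card (Equiv.Perm α) * Fintype.card (Equiv.Perm β) : ℕ) : R) * M.det := by
    -- Expanding both minors by the Leibniz formula, each fixed pair `τ` contributes one full copy
    -- of `M.det`, by the substitution of `σ * (τ.1 ⊕ τ.2)` for `σ`. This overcounting is why the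
    -- product of factorials has to be a unit.
    have h1 : ∀ τ : Equiv.Perm α × Equiv.Perm β, ∑ σ : Equiv.Perm (α ⊕ β),
        ((Equiv.Perm.sign σ : ℤ) : R) *
          ((((Equiv.Perm.sign τ.1 : ℤ) : R) * ∏ i, M (σ (Sum.inl (τ.1 i))) (Sum.inl i)) *
          (((Equiv.Perm.sign τ.2 : ℤ) : R) * ∏ i, M (σ (Sum.inr (τ.2 i))) (Sum.inr i))) =
        M.det := by
      intro τ
      rw [Matrix.det_apply',
        ← Equiv.sum_comp (Equiv.mulRight (Equiv.sumCongr τ.1 τ.2 : Equiv.Perm (α ⊕ β)))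
          fun σ => ((Equiv.Perm.sign σ : ℤ) : R) * ∏ i, M (σ i) i]
      refine Finset.sum_congr rfl fun σ _ => ?_
      simp only [Equiv.coe_mulRight, Equiv.Perm.sign_mul, Equiv.Perm.sign_sumCongr,
        Fintype.prod_sum_type, Equiv.Perm.mul_apply, Equiv.sumCongr_apply, Sum.map_inl,
        Sum.map_inr]
      push_cast
      ring
    calc _ = ∑ τ : Equiv.Perm α × Equiv.Perm β, M.det := by
          rw [← Finset.sum_congr rfl fun τ _ => h1 τ, Finset.sum_comm]
          refine Finset.sum_congr rfl fun σ _ => ?_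
          rw [Matrix.det_apply', Matrix.det_apply', Finset.sum_mul_sum, ← Finset.mul_sum,
            ← Finset.univ_product_univ, Finset.sum_product]
          rfl
      _ = _ := by simp [Fintype.card_prod]
  have h2 : ((Fintype.card (Equiv.Perm α) * Fintype.card (Equiv.Perm β) : ℕ) : R) *
      (M.det * c) ∈ J := by
    rw [← mul_assoc, ← key, Finset.sum_mul]
    refine J.sum_mem fun σ _ => ?_
    rw [mul_assoc]
    exact J.mul_mem_left _ (h σ)
  exact (Ideal.unit_mul_mem_iff_mem J hu).1 h2

/-- Replacing the monomials of degree at least `s` by multiples of `f` is a unitriangular change of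
basis and keeps the determinant. The complementary minors of the new matrix are a Vandermonde
determinant and one whose rows are scaled by the values of `f`. -/
theorem det_vandermonde_sum_mul_mem {s m : ℕ} (v : Fin s ⊕ Fin m → R) (f : Polynomial R)
    (hf : f.Monic) (hdeg : f.natDegree = s) (J : Ideal R) (c : R)
    (hu : IsUnit ((s.factorial * m.factorial : ℕ) : R))
    (h : ∀ σ : Equiv.Perm (Fin s ⊕ Fin m),
      (Matrix.vandermonde fun i => v (σ (Sum.inl i))).det *
        ((∏ k, f.eval (v (σ (Sum.inr k)))) *
          (Matrix.vandermonde fun i => v (σ (Sum.inr i))).det) * c ∈ J) :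
    (Matrix.vandermonde (v ∘ finSumFinEquiv.symm)).det * c ∈ J := by
  nontriviality R
  set P : Fin (s + m) → Polynomial R :=
    Fin.addCases (fun i => Polynomial.X ^ (i : ℕ)) (fun i => f * Polynomial.X ^ (i : ℕ)) with hP
  have hdet : (Matrix.vandermonde (v ∘ finSumFinEquiv.symm)).det =
      (Matrix.of fun i j => (P (finSumFinEquiv j)).eval (v i)).det := by
    rw [Matrix.det_eval_matrixOfPolynomials_eq_det_vandermonde (v ∘ finSumFinEquiv.symm) P,
      ← Matrix.det_submatrix_equiv_self finSumFinEquiv]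
    · congr 1
      ext i j
      simp
    · intro i
      refine Fin.addCases (fun i => ?_) (fun i => ?_) i
      · simp [hP]
      · simp [hP, hf.natDegree_mul (Polynomial.monic_X_pow _), hdeg]
    · intro i
      refine Fin.addCases (fun i => ?_) (fun i => ?_) i
      · simp [hP, Polynomial.monic_X_pow]
      · simp [hP, hf.mul (Polynomial.monic_X_pow _)]
  rw [hdet]
  refine det_mul_mem_of_forall_minors _ J c (by simpa [Fintype.card_perm] using hu) fun σ => ?_
  have h2 : (Matrix.of fun b i : Fin m => (Matrix.of fun i j =>
      (P (finSumFinEquiv j)).eval (v i)) (σ (Sum.inr b)) (Sum.inr i)).det =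
      (∏ k, f.eval (v (σ (Sum.inr k)))) *
          (Matrix.vandermonde fun i => v (σ (Sum.inr i))).det := by
    rw [← Matrix.det_mul_column]
    congr 1
    ext b i
    simp [hP, Matrix.vandermonde_apply]
  rw [h2]
  convert h σ using 4
  ext a i
  simp [hP, Matrix.vandermonde_apply]

theorem det_vandermonde_append {m k : ℕ} (v : Fin m → R) (w : Fin k → R) :
    (Matrix.vandermonde (Fin.append v w)).det =
      (Matrix.vandermonde v).det * (Matrix.vandermonde w).det * ∏ i, ∏ j, (w j - v i) := by
  have hI : ∀ (m : ℕ) (u : Fin m → R),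
      (Matrix.vandermonde u).det = ∏ i, ∏ j, if i < j then u j - u i else 1 := by
    intro m u
    rw [Matrix.det_vandermonde]
    refine Finset.prod_congr rfl fun i _ => ?_
    rw [← Finset.prod_filter]
    congr 1
    ext j
    simp
  have h1 : ∀ (i : Fin m) (j : Fin k), Fin.castAdd k i < Fin.natAdd m j := by
    intro i j
    rw [Fin.lt_def]
    simp
    omega
  have h2 : ∀ i j : Fin m, Fin.castAdd k i < Fin.castAdd k j ↔ i < j := fun _ _ => Iff.rfl
  simp only [hI, Fin.prod_univ_add, Fin.append_left, Fin.append_right, h1, if_true,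
    (h1 _ _).not_gt, if_false, Finset.prod_const_one, Finset.prod_mul_distrib,
    Fin.natAdd_lt_natAdd_iff, h2]
  ring

theorem associated_det_vandermonde_comp {m : ℕ} (v : Fin m → R) (σ : Equiv.Perm (Fin m)) :
    Associated (Matrix.vandermonde (v ∘ σ)).det (Matrix.vandermonde v).det := by
  have h : Matrix.vandermonde (v ∘ σ) = (Matrix.vandermonde v).submatrix σ id := rfl
  rw [h, Matrix.det_permute]
  exact associated_unit_mul_left _ _ ((Equiv.Perm.sign σ).isUnit.map (Int.castRingHom R))

end Determinants

/-! ### Vandermonde determinants of squared variables, up to sign. -/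

open MvPolynomial

section Delta

variable (K : Type*) [Field K] {n : ℕ}

/-- The Vandermonde determinant of the squares of the variables with indices `t`. -/
noncomputable def sqVandermonde {m : ℕ} (t : Fin m → Fin n) : MvPolynomial (Fin n) K :=
  (Matrix.vandermonde fun i => (X (t i) : MvPolynomial (Fin n) K) ^ 2).det

/-- The Vandermonde determinant of the squares of the variables with indices in `A`. -/
noncomputable def delta (A : Finset (Fin n)) : MvPolynomial (Fin n) K :=
  sqVandermonde K (A.orderEmbOfFin rfl)

variable {K}

theorem associated_prod_of_forall {M ι : Type*} [CommMonoid M] (s : Finset ι) {f g : ι → M}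
    (h : ∀ i ∈ s, Associated (f i) (g i)) : Associated (∏ i ∈ s, f i) (∏ i ∈ s, g i) := by
  classical
  induction s using Finset.induction_on with
  | empty => simp
  | insert a s ha ih =>
    rw [Finset.prod_insert ha, Finset.prod_insert ha]
    exact (h a (Finset.mem_insert_self a s)).mul_mul
      (ih fun i hi => h i (Finset.mem_insert_of_mem hi))

theorem associated_expand_vandermonde {m : ℕ} (t : Fin m → Fin n) :
    Associated (expand 2 (vandermonde K t)) (sqVandermonde K t) := by
  rw [sqVandermonde, Matrix.det_vandermonde, vandermonde, map_prod]
  refine associated_prod_of_forall _ fun i _ => ?_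
  rw [map_prod]
  refine associated_prod_of_forall _ fun j _ => ?_
  rw [map_sub, expand_X, expand_X, ← neg_sub]
  exact (Associated.refl _).neg_left

/-- Reordering the entries only changes the sign, so up to units a column is the set of its entries.
-/
theorem associated_sqVandermonde_delta {m : ℕ} {t : Fin m → Fin n} (ht : Function.Injective t)
    {A : Finset (Fin n)} (hA : ∀ a, a ∈ A ↔ ∃ i, t i = a) :
    Associated (sqVandermonde K t) (delta K A) := by
  have hcard : A.card = m := by
    have : A = Finset.univ.image t := by ext a; simp [hA]
    rw [this, Finset.card_image_of_injective _ ht, Finset.card_univ, Fintype.card_fin]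
  subst hcard
  have hmem : ∀ i, ∃ j, A.orderEmbOfFin rfl j = t i := by
    intro i
    have := Finset.range_orderEmbOfFin A rfl
    have h2 : t i ∈ Set.range (A.orderEmbOfFin rfl) := by
      rw [this]; exact (hA _).2 ⟨i, rfl⟩
    exact h2
  choose σ hσ using hmem
  have hinj : Function.Injective σ := fun i j h => ht (by rw [← hσ i, ← hσ j, h])
  have hbij : Function.Bijective σ := Finite.injective_iff_bijective.1 hinj
  have : (fun i => (X (t i) : MvPolynomial (Fin n) K) ^ 2) =
      (fun i => (X (A.orderEmbOfFin rfl i) : MvPolynomial (Fin n) K) ^ 2) ∘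
        (Equiv.ofBijective σ hbij) := by
    ext1 i
    simp [hσ]
  rw [delta, sqVandermonde, sqVandermonde, this]
  exact associated_det_vandermonde_comp _ _

theorem associated_delta_union {A B : Finset (Fin n)} (h : Disjoint A B) :
    Associated (delta K (A ∪ B))
      (delta K A * delta K B * ∏ a ∈ A, ∏ b ∈ B, ((X a) ^ 2 - (X b) ^ 2)) := by
  have h1 : Function.Injective (Fin.append (A.orderEmbOfFin rfl) (B.orderEmbOfFin rfl)) := by
    rw [Fin.append_injective_iff]
    refine ⟨(A.orderEmbOfFin rfl).injective, (B.orderEmbOfFin rfl).injective, fun i j hij => ?_⟩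
    have ha := A.orderEmbOfFin_mem rfl i
    rw [hij] at ha
    exact Finset.disjoint_left.1 h ha (B.orderEmbOfFin_mem rfl j)
  have hr : ∀ (C : Finset (Fin n)) a, a ∈ C ↔ ∃ i, C.orderEmbOfFin rfl i = a := by
    intro C a
    have := Finset.range_orderEmbOfFin C rfl
    rw [← Finset.mem_coe, ← this]
    rfl
  refine (associated_sqVandermonde_delta h1 ?_).symm.trans ?_
  · intro a
    rw [Finset.mem_union, hr A, hr B]
    constructor
    · rintro (⟨i, rfl⟩ | ⟨i, rfl⟩)
      · exact ⟨Fin.castAdd _ i, by simp⟩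
      · exact ⟨Fin.natAdd _ i, by simp⟩
    · rintro ⟨i, rfl⟩
      refine Fin.addCases (fun i => ?_) (fun i => ?_) i
      · exact Or.inl ⟨i, by simp⟩
      · exact Or.inr ⟨i, by simp⟩
  · have h2 : (fun i => (X (Fin.append (A.orderEmbOfFin rfl) (B.orderEmbOfFin rfl) i) :
        MvPolynomial (Fin n) K) ^ 2) =
        Fin.append (fun i => X (A.orderEmbOfFin rfl i) ^ 2)
          (fun i => X (B.orderEmbOfFin rfl i) ^ 2) := by
      ext1 i
      refine Fin.addCases (fun i => ?_) (fun i => ?_) i <;> simp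
    rw [sqVandermonde, h2, det_vandermonde_append]
    refine Associated.mul_mul (Associated.refl _) ?_
    have h3 : ∀ (C : Finset (Fin n)) (F : Fin n → MvPolynomial (Fin n) K),
        ∏ a ∈ C, F a = ∏ i, F (C.orderEmbOfFin rfl i) := by
      intro C F
      conv_lhs => rw [← Finset.map_orderEmbOfFin_univ C rfl, Finset.prod_map]
      rfl
    rw [h3]
    refine associated_prod_of_forall _ fun i _ => ?_
    rw [h3]
    refine associated_prod_of_forall _ fun j _ => ?_
    rw [← neg_sub]
    exact (Associated.refl _).neg_left

/-- The Laplace step for a column: `A'` is the set of entries chosen for the last `m` columns of the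
matrix. The free choice of `f` allows these entries to be merged with another column. -/
theorem mul_delta_mem [CharZero K] {A : Finset (Fin n)} {s m : ℕ} (hA : A.card = s + m)
    (f : Polynomial (MvPolynomial (Fin n) K)) (hf : f.Monic) (hdeg : f.natDegree = s)
    (J : Ideal (MvPolynomial (Fin n) K)) (c : MvPolynomial (Fin n) K)
    (h : ∀ A' ⊆ A, A'.card = m →
      c * (delta K (A \ A') * delta K A' * ∏ a ∈ A', f.eval (X a ^ 2)) ∈ J) :
    c * delta K A ∈ J := by
  set t : Fin s ⊕ Fin m → Fin n := fun i => A.orderEmbOfFin hA (finSumFinEquiv i) with ht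
  have htinj : Function.Injective t :=
    (A.orderEmbOfFin hA).injective.comp finSumFinEquiv.injective
  have hmem : ∀ a, a ∈ A ↔ ∃ i, t i = a := by
    intro a
    have := Finset.range_orderEmbOfFin A hA
    rw [← Finset.mem_coe, ← this]
    constructor
    · rintro ⟨i, rfl⟩
      exact ⟨finSumFinEquiv.symm i, by simp [ht]⟩
    · rintro ⟨i, rfl⟩
      exact ⟨_, rfl⟩
  have hassoc : Associated
      (Matrix.vandermonde ((fun i => (X (t i) : MvPolynomial (Fin n) K) ^ 2) ∘
        finSumFinEquiv.symm)).det (delta K A) := by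
    refine associated_sqVandermonde_delta (t := t ∘ finSumFinEquiv.symm)
      (htinj.comp finSumFinEquiv.symm.injective) fun a => ?_
    rw [hmem]
    exact finSumFinEquiv.symm.surjective.exists
  refine J.mem_of_dvd (mul_dvd_mul_left c hassoc.symm.dvd') ?_
  rw [mul_comm]
  have hu : IsUnit ((s.factorial * m.factorial : ℕ) : MvPolynomial (Fin n) K) := by
    rw [← map_natCast (C : K →+* MvPolynomial (Fin n) K)]
    refine IsUnit.map _ (IsUnit.mk0 _ ?_)
    exact_mod_cast (Nat.mul_pos s.factorial_pos m.factorial_pos).ne'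
  refine det_vandermonde_sum_mul_mem _ f hf hdeg J c hu fun σ => ?_
  set A' := Finset.univ.image fun k : Fin m => t (σ (Sum.inr k)) with hA'
  have hinr : Function.Injective fun k : Fin m => t (σ (Sum.inr k)) :=
    htinj.comp (σ.injective.comp Sum.inr_injective)
  have hinl : Function.Injective fun k : Fin s => t (σ (Sum.inl k)) :=
    htinj.comp (σ.injective.comp Sum.inl_injective)
  have e1 : Associated (sqVandermonde K fun k : Fin s => t (σ (Sum.inl k)))
      (delta K (A \ A')) := by
    refine associated_sqVandermonde_delta hinl fun a => ?_
    rw [Finset.mem_sdiff, hmem, hA']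
    simp only [Finset.mem_image, Finset.mem_univ, true_and]
    constructor
    · rintro ⟨⟨i, rfl⟩, h2⟩
      rcases hi : σ.symm i with k | k
      · exact ⟨k, by rw [← hi]; simp⟩
      · exact absurd ⟨k, by rw [← hi]; simp⟩ h2
    · rintro ⟨k, rfl⟩
      refine ⟨⟨_, rfl⟩, ?_⟩
      rintro ⟨l, hl⟩
      have := σ.injective (htinj hl)
      simp at this
  have e2 : Associated (sqVandermonde K fun k : Fin m => t (σ (Sum.inr k))) (delta K A') :=
    associated_sqVandermonde_delta hinr fun a => by simp [hA']
  have e3 : ∏ a ∈ A', f.eval (X a ^ 2) = ∏ k, f.eval (X (t (σ (Sum.inr k))) ^ 2) := by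
    rw [hA', Finset.prod_image fun a _ b _ hab => hinr hab]
  have h1 := h A' (fun a ha => by
    rw [hmem]
    obtain ⟨k, _, rfl⟩ := Finset.mem_image.1 ha
    exact ⟨_, rfl⟩) (by rw [hA', Finset.card_image_of_injective _ hinr]; simp)
  refine J.mem_of_dvd (Associated.dvd ?_) h1
  rw [e3, mul_comm c]
  refine Associated.mul_mul ?_ (Associated.refl c)
  refine Associated.trans (y := sqVandermonde K (fun k : Fin s => t (σ (Sum.inl k))) *
    sqVandermonde K (fun k : Fin m => t (σ (Sum.inr k))) *
      ∏ k, f.eval (X (t (σ (Sum.inr k))) ^ 2)) ?_ ?_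
  · exact (e1.symm.mul_mul e2.symm).mul_mul (Associated.refl _)
  · rw [mul_assoc, mul_comm (sqVandermonde K fun k : Fin m => t (σ (Sum.inr k)))]
    exact Associated.refl _

end Delta

end Specht

/-! ### Colorings by columns, and the ideal membership for dominated shapes. -/

namespace Specht

open MvPolynomial

/-- An assignment of the elements of `Fin n` to columns of the first diagram (`false`) or of the
second diagram (`true`). -/
abbrev Coloring (n : ℕ) : Type := Fin n → Bool × Fin (n + 1)

namespace Coloring

variable {n : ℕ}

/-- The elements assigned to the column `c`. -/
def fiber (g : Coloring n) (c : Bool × Fin (n + 1)) : Finset (Fin n) :=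
  Finset.univ.filter fun i => g i = c

@[simp]
theorem mem_fiber {g : Coloring n} {c : Bool × Fin (n + 1)} {i : Fin n} :
    i ∈ g.fiber c ↔ g i = c := by
  simp [fiber]

/-- The product of the variables assigned to the second diagram. -/
noncomputable def mon (K : Type*) [Field K] (g : Coloring n) : MvPolynomial (Fin n) K :=
  ∏ i, X i ^ (g i).1.toNat

/-- The `B_n` Specht polynomial, up to sign, of a tableau with the columns given by `g`. -/
noncomputable def poly (K : Type*) [Field K] (g : Coloring n) : MvPolynomial (Fin n) K :=
  (∏ c, delta K (g.fiber c)) * g.mon K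

/-- Move the elements of `A` to the column `b`. -/
def recolor (g : Coloring n) (A : Finset (Fin n)) (b : Bool × Fin (n + 1)) : Coloring n :=
  fun i => if i ∈ A then b else g i

theorem fiber_recolor_self (g : Coloring n) (A : Finset (Fin n)) (b : Bool × Fin (n + 1)) :
    (g.recolor A b).fiber b = A ∪ g.fiber b := by
  ext i
  by_cases h : i ∈ A <;> simp [recolor, h]

theorem fiber_recolor_of_ne (g : Coloring n) (A : Finset (Fin n)) {b c : Bool × Fin (n + 1)}
    (h : c ≠ b) : (g.recolor A b).fiber c = g.fiber c \ A := by
  ext i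
  by_cases hi : i ∈ A
  · simp [recolor, hi, h.symm]
  · simp [recolor, hi]

theorem disjoint_fiber (g : Coloring n) {b c : Bool × Fin (n + 1)} (h : c ≠ b) :
    Disjoint (g.fiber c) (g.fiber b) := by
  rw [Finset.disjoint_left]
  intro i hi hj
  rw [mem_fiber] at hi hj
  exact h (hi.symm.trans hj)

theorem poly_eq (K : Type*) [Field K] (g : Coloring n) {a b : Bool × Fin (n + 1)} (hab : a ≠ b) :
    g.poly K = delta K (g.fiber a) * delta K (g.fiber b) *
      (∏ c ∈ (Finset.univ.erase a).erase b, delta K (g.fiber c)) * g.mon K := by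
  rw [poly, ← Finset.mul_prod_erase _ _ (Finset.mem_univ a),
    ← Finset.mul_prod_erase (Finset.univ.erase a) _ (Finset.mem_erase.2 ⟨hab.symm,
      Finset.mem_univ b⟩), ← mul_assoc (delta K (g.fiber a))]

/-- If all the polynomials obtained by moving `m` elements from the column `a` to the column `b`
lie in an ideal, so does the polynomial of `g`. -/
theorem poly_mem_of_recolor {K : Type*} [Field K] [CharZero K] (g : Coloring n)
    {a b : Bool × Fin (n + 1)} (hab : a ≠ b) {s m : ℕ} (ha : (g.fiber a).card = s + m)
    (hb : (g.fiber b).card ≤ s) (hb' : a.1 = false → b.1 = true → (g.fiber b).card < s)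
    (J : Ideal (MvPolynomial (Fin n) K))
    (hJ : ∀ A ⊆ g.fiber a, A.card = m → (g.recolor A b).poly K ∈ J) : g.poly K ∈ J := by
  set u := (g.fiber b).card with hu
  set rest := ∏ c ∈ (Finset.univ.erase a).erase b, delta K (g.fiber c) with hrest
  have e0 : g.poly K = delta K (g.fiber b) * rest * g.mon K * delta K (g.fiber a) := by
    rw [poly_eq K g hab]; ring
  rw [e0]
  -- At the square of an entry of `A`, `P` gives exactly the cross factors that merge `A` with the
  -- column `b`; the power of `X` below pads the degree from `u` to `s`.
  set P : Polynomial (MvPolynomial (Fin n) K) :=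
    ∏ i ∈ g.fiber b, (Polynomial.X - Polynomial.C (X i ^ 2)) with hP
  have hPm : P.Monic := Polynomial.monic_prod_of_monic _ _ fun i _ => Polynomial.monic_X_sub_C _
  have hPd : P.natDegree = u := by
    rw [hP, Polynomial.natDegree_prod_of_monic _ _ fun i _ => Polynomial.monic_X_sub_C _]
    simp only [Polynomial.natDegree_X_sub_C, Finset.sum_const, smul_eq_mul, mul_one, hu]
  refine mul_delta_mem ha (P * Polynomial.X ^ (s - u)) (hPm.mul (Polynomial.monic_X_pow _)) ?_
    J _ fun A hA hAm => ?_
  · rw [hPm.natDegree_mul (Polynomial.monic_X_pow _), hPd, Polynomial.natDegree_X_pow]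
    omega
  refine J.mem_of_dvd ?_ (hJ A hA hAm)
  have hdisj : Disjoint A (g.fiber b) := Finset.disjoint_of_subset_left hA (g.disjoint_fiber hab)
  have h1 : ∏ x ∈ A, (P * Polynomial.X ^ (s - u)).eval (X x ^ 2) =
      (∏ x ∈ A, ∏ y ∈ g.fiber b, (X x ^ 2 - X y ^ 2)) * ∏ x ∈ A, (X x ^ 2) ^ (s - u) := by
    rw [← Finset.prod_mul_distrib]
    refine Finset.prod_congr rfl fun x _ => ?_
    simp [hP, Polynomial.eval_prod]
  -- Only a move from the first diagram to the second needs an additional factor `X x`; there `u <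
  -- s` by `hb'`, so the padding provides it.
  have h2 : (g.recolor A b).mon K ∣ g.mon K * ∏ x ∈ A, (X x ^ 2) ^ (s - u) := by
    have h : ∏ x ∈ A, (X x ^ 2 : MvPolynomial (Fin n) K) ^ (s - u) =
        ∏ x, if x ∈ A then (X x ^ 2) ^ (s - u) else 1 := by simp
    rw [h, mon, mon, ← Finset.prod_mul_distrib]
    refine Finset.prod_dvd_prod_of_dvd _ _ fun x _ => ?_
    by_cases hx : x ∈ A
    · have hxa : g x = a := mem_fiber.1 (hA hx)
      simp only [recolor, hx, if_true, hxa, ← pow_mul, ← pow_add]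
      refine pow_dvd_pow _ ?_
      rcases a with ⟨_ | _, a⟩ <;> rcases b with ⟨_ | _, b⟩ <;>
        simp only [Bool.toNat_false, Bool.toNat_true, true_imp_iff] at hb' ⊢ <;> omega
    · simp [recolor, hx]
  have h3 : ∏ c ∈ (Finset.univ.erase a).erase b, delta K ((g.recolor A b).fiber c) = rest := by
    refine Finset.prod_congr rfl fun c hc => ?_
    rw [Finset.mem_erase, Finset.mem_erase] at hc
    rw [fiber_recolor_of_ne _ _ hc.1, Finset.sdiff_eq_self_of_disjoint]
    exact Finset.disjoint_of_subset_right hA (g.disjoint_fiber hc.2.1)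
  rw [poly_eq K _ hab, h3, fiber_recolor_self, fiber_recolor_of_ne _ _ hab, h1]
  obtain ⟨w, hw⟩ := h2
  obtain ⟨w', hw'⟩ := (associated_delta_union (K := K) hdisj).dvd
  refine ⟨w * w', ?_⟩
  calc _ = delta K (g.fiber a \ A) * rest * (g.mon K * ∏ x ∈ A, (X x ^ 2) ^ (s - u)) *
        (delta K A * delta K (g.fiber b) * ∏ x ∈ A, ∏ y ∈ g.fiber b, (X x ^ 2 - X y ^ 2)) := by
        ring
    _ = _ := by rw [hw, hw']; ring

/-- The number of the first `k` positions `T₀, S₀, T₁, S₁, …` that belong to the first diagram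
(`false`) or to the second diagram (`true`). -/
def cap (b : Bool) (k : ℕ) : ℕ := (k + 1 - b.toNat) / 2

theorem cap_decide (j k : ℕ) : cap (decide (j % 2 = 1)) k = (k + 1 - j % 2) / 2 := by
  rcases Nat.mod_two_eq_zero_or_one j with h | h <;> simp [cap, h]

/-- The lengths of the rows of a tableau with the columns given by `g`, those of the first diagram
at the even positions and those of the second diagram at the odd positions. -/
def rowSeq (g : Coloring n) (k : ℕ) : ℕ :=
  (Finset.univ.filter fun c : Fin (n + 1) => k / 2 < (g.fiber (decide (k % 2 = 1), c)).card).card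

/-- Counts the boxes in the first `k` rows column by column: a column contributes its height,
truncated at the number of these rows in its diagram. -/
theorem sum_range_rowSeq (g : Coloring n) (k : ℕ) :
    ∑ l ∈ Finset.range k, g.rowSeq l = ∑ c, min (g.fiber c).card (cap c.1 k) := by
  induction k with
  | zero =>
    rw [Finset.sum_range_zero, eq_comm, Finset.sum_eq_zero]
    rintro ⟨b, c⟩ -
    cases b <;> simp [cap]
  | succ k ih =>
    rw [Finset.sum_range_succ, ih, rowSeq, Finset.card_filter, Fintype.sum_prod_type,
      Fintype.sum_prod_type, Fintype.sum_bool, Fintype.sum_bool]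
    rcases Nat.mod_two_eq_zero_or_one k with h | h
    · simp only [h]
      rw [add_assoc, ← Finset.sum_add_distrib]
      congr 1
      · refine Finset.sum_congr rfl fun c _ => ?_
        congr 1
        simp [cap]
        omega
      · refine Finset.sum_congr rfl fun c _ => ?_
        simp [cap]
        split_ifs <;> omega
    · simp only [h]
      rw [add_right_comm, ← Finset.sum_add_distrib]
      congr 1
      · refine Finset.sum_congr rfl fun c _ => ?_
        simp [cap]
        split_ifs <;> omega
      · refine Finset.sum_congr rfl fun c _ => ?_
        congr 1
        simp [cap]
        omega

theorem sum_card_fiber (g : Coloring n) : ∑ c, (g.fiber c).card = n := by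
  have := Finset.card_eq_sum_card_fiberwise (s := Finset.univ) (t := Finset.univ) (f := g)
    (fun _ _ => Finset.mem_coe.2 (Finset.mem_univ _))
  simpa [fiber] using this.symm

theorem card_fiber_le (g : Coloring n) (c : Bool × Fin (n + 1)) : (g.fiber c).card ≤ n := by
  simpa using Finset.card_le_univ (g.fiber c)

theorem rowSeq_add_two_le (g : Coloring n) (k : ℕ) : g.rowSeq (k + 2) ≤ g.rowSeq k := by
  rw [rowSeq, rowSeq, Nat.add_mod_right]
  refine Finset.card_le_card fun c hc => ?_
  rw [Finset.mem_filter] at hc ⊢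
  exact ⟨hc.1, by omega⟩

theorem rowSeq_eq_zero (g : Coloring n) {k : ℕ} (hk : 2 * n ≤ k) : g.rowSeq k = 0 := by
  rw [rowSeq, Finset.card_eq_zero, Finset.filter_eq_empty_iff]
  intro c _
  have := g.card_fiber_le (decide (k % 2 = 1), c)
  omega

theorem sum_range_rowSeq_eq (g : Coloring n) {k : ℕ} (hk : 2 * n ≤ k) :
    ∑ l ∈ Finset.range k, g.rowSeq l = n := by
  rw [sum_range_rowSeq]
  conv_rhs => rw [← g.sum_card_fiber]
  refine Finset.sum_congr rfl fun c _ => min_eq_left ?_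
  have := g.card_fiber_le c
  have : n ≤ cap c.1 k := by
    have := Bool.toNat_le c.1
    unfold cap
    omega
  omega

/-- A removable box is the bottom of a column that ends in its row. -/
theorem exists_card_fiber_eq_of_rowSeq_lt (g : Coloring n) {k : ℕ}
    (h : g.rowSeq (k + 2) < g.rowSeq k) :
    ∃ c, (g.fiber (decide (k % 2 = 1), c)).card = k / 2 + 1 := by
  by_contra! hne
  refine h.not_ge ?_
  rw [rowSeq, rowSeq, Nat.add_mod_right]
  refine Finset.card_le_card fun c hc => ?_
  rw [Finset.mem_filter] at hc ⊢
  have := hne c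
  exact ⟨hc.1, by omega⟩

/-- There are `n + 1` columns for only `n` elements; the spare column allows a new column to be
started. -/
theorem exists_fiber_eq_empty (g : Coloring n) (b : Bool) : ∃ c, g.fiber (b, c) = ∅ := by
  by_contra! h
  choose f hf using fun c => (h c)
  have hinj : Function.Injective f := by
    intro c c' hcc
    have h1 := mem_fiber.1 (hf c)
    have h2 := mem_fiber.1 (hf c')
    rw [hcc, h2] at h1
    exact (Prod.ext_iff.1 h1).2.symm
  have := Fintype.card_le_of_injective f hinj
  simp at this

theorem exists_card_fiber_eq_div_two (g : Coloring n) {k : ℕ}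
    (h : k < 2 ∨ g.rowSeq k < g.rowSeq (k - 2)) :
    ∃ c, (g.fiber (decide (k % 2 = 1), c)).card = k / 2 := by
  rcases lt_or_ge k 2 with hk | hk
  · obtain ⟨c, hc⟩ := g.exists_fiber_eq_empty (decide (k % 2 = 1))
    exact ⟨c, by rw [hc, Finset.card_empty]; omega⟩
  · obtain ⟨l, rfl⟩ : ∃ l, k = l + 2 := ⟨k - 2, by omega⟩
    rw [Nat.add_sub_cancel] at h
    obtain ⟨c, hc⟩ := g.exists_card_fiber_eq_of_rowSeq_lt (h.resolve_left (by omega))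
    exact ⟨c, by rw [Nat.add_mod_right, hc]; omega⟩

/-- Only the columns `a` and `b` change their heights. -/
theorem sum_range_rowSeq_recolor (g : Coloring n) {a b : Bool × Fin (n + 1)} (hab : a ≠ b)
    {A : Finset (Fin n)} (hA : A ⊆ g.fiber a) (k : ℕ) :
    ∑ l ∈ Finset.range k, (g.recolor A b).rowSeq l + min (g.fiber a).card (cap a.1 k) +
        min (g.fiber b).card (cap b.1 k) =
      ∑ l ∈ Finset.range k, g.rowSeq l + min ((g.fiber a).card - A.card) (cap a.1 k) +
        min ((g.fiber b).card + A.card) (cap b.1 k) := by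
  have hb : b ∈ Finset.univ.erase a := Finset.mem_erase.2 ⟨hab.symm, Finset.mem_univ b⟩
  have hdisj : Disjoint A (g.fiber b) := Finset.disjoint_of_subset_left hA (g.disjoint_fiber hab)
  rw [sum_range_rowSeq, sum_range_rowSeq, ← Finset.add_sum_erase _ _ (Finset.mem_univ a),
    ← Finset.add_sum_erase _ _ hb,
    ← Finset.add_sum_erase Finset.univ (fun c => min (g.fiber c).card _) (Finset.mem_univ a),
    ← Finset.add_sum_erase (Finset.univ.erase a) (fun c => min (g.fiber c).card _) hb,
    fiber_recolor_self, fiber_recolor_of_ne _ _ hab, Finset.card_union_of_disjoint hdisj,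
    Finset.card_sdiff_of_subset hA]
  have h3 : ∑ c ∈ (Finset.univ.erase a).erase b,
      min ((g.recolor A b).fiber c).card (cap c.1 k) =
      ∑ c ∈ (Finset.univ.erase a).erase b, min (g.fiber c).card (cap c.1 k) := by
    refine Finset.sum_congr rfl fun c hc => ?_
    rw [Finset.mem_erase, Finset.mem_erase] at hc
    rw [fiber_recolor_of_ne _ _ hc.1, Finset.sdiff_eq_self_of_disjoint]
    exact Finset.disjoint_of_subset_right hA (g.disjoint_fiber hc.2.1)
  rw [h3]
  omega

/-- If an ideal contains the polynomials of all colorings with the row lengths `p`, it contains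
the polynomials of all colorings dominated by `p`. -/
theorem poly_mem_of_dominates {K : Type*} [Field K] [CharZero K]
    (J : Ideal (MvPolynomial (Fin n) K)) {p : ℕ → ℕ} (hp : ∀ k, p (k + 2) ≤ p k)
    (hpN : ∀ k, 2 * n ≤ k → p k = 0) (htot : ∑ l ∈ Finset.range (2 * n), p l = n)
    (hJ : ∀ g : Coloring n, g.rowSeq = p → g.poly K ∈ J) (g : Coloring n)
    (hg : ∀ k, ∑ l ∈ Finset.range k, g.rowSeq l ≤ ∑ l ∈ Finset.range k, p l) : g.poly K ∈ J := by
  -- The induction is on the sum over `k` of the gaps between the prefix sums, which every transfer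
  -- decreases.
  obtain ⟨N, hN⟩ : ∃ N, ∑ k ∈ Finset.range (2 * n + 1), ∑ l ∈ Finset.range k, p l -
    ∑ k ∈ Finset.range (2 * n + 1), ∑ l ∈ Finset.range k, g.rowSeq l < N := ⟨_, Nat.lt_succ_self _⟩
  induction N generalizing g with
  | zero => omega
  | succ N ih =>
    by_cases hne : g.rowSeq = p
    · exact hJ g hne
    obtain ⟨i, j, m, hm, hij, hmj, hi, hj, hlt⟩ := exists_transfer g.rowSeq_add_two_le hp (2 * n)
      (fun k => g.rowSeq_eq_zero) hpN hg ((g.sum_range_rowSeq_eq le_rfl).trans htot.symm) hne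
    have hjn : j < 2 * n := by
      by_contra! h
      rw [g.rowSeq_eq_zero h] at hj
      omega
    obtain ⟨ca, hca⟩ := g.exists_card_fiber_eq_of_rowSeq_lt hj
    obtain ⟨cb, hcb⟩ := g.exists_card_fiber_eq_div_two hi
    have hab : (decide (j % 2 = 1), ca) ≠ (decide (i % 2 = 1), cb) := by
      intro h
      rw [h] at hca
      omega
    refine g.poly_mem_of_recolor hab (s := j / 2 + 1 - m) (m := m) (by omega) (by omega) ?_ J
      fun A hA hAm => ?_
    · intro h1 h2
      simp only [decide_eq_false_iff_not, decide_eq_true_eq] at h1 h2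
      omega
    -- The `k`-th prefix sum grows by one exactly for those `k` for which `hlt` provides strict
    -- inequality, and is otherwise unchanged.
    have hrec := fun k => g.sum_range_rowSeq_recolor hab hA k
    simp only [hca, hcb, hAm, cap_decide] at hrec
    have hmono : ∀ k, ∑ l ∈ Finset.range k, g.rowSeq l ≤
        ∑ l ∈ Finset.range k, (g.recolor A (decide (i % 2 = 1), cb)).rowSeq l := by
      intro k
      have := hrec k
      rcases hmj with rfl | hmj <;> omega
    have hdom : ∀ k, ∑ l ∈ Finset.range k, (g.recolor A (decide (i % 2 = 1), cb)).rowSeq l ≤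
        ∑ l ∈ Finset.range k, p l := by
      intro k
      have h1 := hrec k
      have h2 := hg k
      by_cases hk : i < k ∧ k ≤ j ∧ (m = 1 ∨ (k - i) % 2 = 1)
      · have h3 := hlt k hk.1 hk.2.1 hk.2.2
        rcases hmj with rfl | hmj <;> omega
      · rcases hmj with rfl | hmj <;> omega
    have hstrict : ∑ k ∈ Finset.range (2 * n + 1), ∑ l ∈ Finset.range k, g.rowSeq l <
        ∑ k ∈ Finset.range (2 * n + 1), ∑ l ∈ Finset.range k,
          (g.recolor A (decide (i % 2 = 1), cb)).rowSeq l := by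
      refine Finset.sum_lt_sum (fun k _ => hmono k) ⟨i + 1, Finset.mem_range.2 (by omega), ?_⟩
      have h1 := hrec (i + 1)
      rcases hmj with rfl | hmj <;> omega
    have hle : ∑ k ∈ Finset.range (2 * n + 1), ∑ l ∈ Finset.range k,
        (g.recolor A (decide (i % 2 = 1), cb)).rowSeq l ≤
        ∑ k ∈ Finset.range (2 * n + 1), ∑ l ∈ Finset.range k, p l :=
      Finset.sum_le_sum fun k _ => hdom k
    exact ih _ hdom (by omega)

end Coloring

end Specht

/-! ### From colorings back to bitableaux and their ideals. -/

namespace Specht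

open MvPolynomial

/-- The sizes of the superlevel sets determine the sizes of the fibers, and fibers of equal size can
be matched. Used to recover column heights from row lengths up to order. -/
theorem exists_perm_of_card_filter_lt_eq {α : Type*} [Fintype α] {f h : α → ℕ}
    (hfh : ∀ k, (Finset.univ.filter fun a => k < f a).card =
      (Finset.univ.filter fun a => k < h a).card) :
    ∃ σ : Equiv.Perm α, ∀ a, h (σ a) = f a := by
  classical
  have hcard : ∀ k, Fintype.card {a // f a = k} = Fintype.card {a // h a = k} := by
    intro k
    rw [Fintype.card_subtype, Fintype.card_subtype]
    have key : ∀ f : α → ℕ, (Finset.univ.filter fun a => f a = k).card +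
        (Finset.univ.filter fun a => k < f a).card =
        if k = 0 then Fintype.card α else (Finset.univ.filter fun a => k - 1 < f a).card := by
      intro f
      rw [← Finset.card_union_of_disjoint (Finset.disjoint_filter.2 fun a _ _ => by omega),
        ← Finset.filter_or]
      split_ifs with hk
      · rw [← Finset.card_univ, Finset.filter_true_of_mem fun a _ => by omega]
      · congr 1
        exact Finset.filter_congr fun a _ => by omega
    have h1 := key f
    have h2 := key h
    rw [hfh k, hfh (k - 1)] at h1
    omega
  exact ⟨Equiv.ofFiberEquiv fun k => Fintype.equivOfCardEq (hcard k),
    fun a => Equiv.ofFiberEquiv_map _ a⟩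

theorem lt_card_of_mem {μ : YoungDiagram} {x : ℕ × ℕ} (h : x ∈ μ.cells) : x.2 < μ.card := by
  have h1 : x.2 < μ.rowLen x.1 := YoungDiagram.mem_iff_lt_rowLen.1 ((YoungDiagram.mem_cells ..).1 h)
  rw [YoungDiagram.rowLen_eq_card] at h1
  exact h1.trans_le (Finset.card_le_card (Finset.filter_subset _ _))

end Specht

namespace Bipartition

open MvPolynomial Specht

variable {n : ℕ}

/-- The first (`false`) or the second (`true`) diagram. -/
def diagram (p : Bipartition n) : Bool → YoungDiagram
  | false => p.fst
  | true => p.snd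

/-- The parts of the two partitions, alternately. -/
def rowSeq (p : Bipartition n) (k : ℕ) : ℕ := (p.diagram (decide (k % 2 = 1))).rowLen (k / 2)

theorem card_diagram_le (p : Bipartition n) (b : Bool) : (p.diagram b).card ≤ n := by
  have := p.card_add_card
  cases b <;> simp only [diagram] <;> omega

theorem sum_range_two_mul_rowSeq (p : Bipartition n) (k : ℕ) :
    ∑ l ∈ Finset.range (2 * k), p.rowSeq l =
      ∑ j ∈ Finset.range k, (p.fst.rowLen j + p.snd.rowLen j) := by
  induction k with
  | zero => simp
  | succ k ih =>
    rw [Finset.sum_range_succ, ← ih, mul_add, mul_one, Finset.sum_range_succ,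
      Finset.sum_range_succ, add_assoc]
    have h : (2 * k + 1) / 2 = k := by omega
    simp [rowSeq, diagram, h]

theorem sum_range_two_mul_add_one_rowSeq (p : Bipartition n) (k : ℕ) :
    ∑ l ∈ Finset.range (2 * k + 1), p.rowSeq l =
      ∑ j ∈ Finset.range k, (p.fst.rowLen j + p.snd.rowLen j) + p.fst.rowLen k := by
  rw [Finset.sum_range_succ, sum_range_two_mul_rowSeq]
  simp [rowSeq, diagram]

theorem le_iff_sum_range_rowSeq_le {p q : Bipartition n} :
    q ≤ p ↔ ∀ k, ∑ l ∈ Finset.range k, q.rowSeq l ≤ ∑ l ∈ Finset.range k, p.rowSeq l := by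
  constructor
  · intro h k
    obtain ⟨l, rfl | rfl⟩ := Nat.even_or_odd' k
    · rw [sum_range_two_mul_rowSeq, sum_range_two_mul_rowSeq]
      cases l with
      | zero => simp
      | succ l => exact (h l).1
    · rw [sum_range_two_mul_add_one_rowSeq, sum_range_two_mul_add_one_rowSeq]
      exact (h l).2
  · intro h k
    rw [← sum_range_two_mul_rowSeq, ← sum_range_two_mul_rowSeq,
      ← sum_range_two_mul_add_one_rowSeq, ← sum_range_two_mul_add_one_rowSeq]
    exact ⟨h _, h _⟩

namespace Bitableau

variable {p : Bipartition n}

instance (p : Bipartition n) : Nonempty p.Bitableau := by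
  refine ⟨Fintype.equivOfCardEq ?_⟩
  simpa using p.card_add_card

/-- The filling of the first (`false`) or of the second (`true`) diagram. -/
def entry (T : Bitableau p) : (b : Bool) → {x // x ∈ (p.diagram b).cells} → Fin n
  | false => T.left
  | true => T.right

theorem entry_injective (T : Bitableau p) (b : Bool) : Function.Injective (T.entry b) := by
  cases b
  · exact (Equiv.injective T).comp Sum.inl_injective
  · exact (Equiv.injective T).comp Sum.inr_injective

theorem exists_entry_eq (T : Bitableau p) (i : Fin n) : ∃ b x, T.entry b x = i := by
  obtain ⟨x | x, rfl⟩ := Equiv.surjective T i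
  · exact ⟨false, x, rfl⟩
  · exact ⟨true, x, rfl⟩

/-- The index of the column of a box. -/
def columnIndex (b : Bool) (x : {x // x ∈ (p.diagram b).cells}) : Fin (n + 1) :=
  ⟨x.1.2, ((lt_card_of_mem x.2).trans_le (p.card_diagram_le b)).trans n.lt_succ_self⟩

/-- The columns of a bitableau. -/
def coloring (T : Bitableau p) : Coloring n := fun i =>
  Sum.elim (fun x => (false, columnIndex false x)) (fun x => (true, columnIndex true x))
    (Equiv.symm T i)

theorem coloring_entry (T : Bitableau p) (b : Bool) (x : {x // x ∈ (p.diagram b).cells}) :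
    T.coloring (T.entry b x) = (b, columnIndex b x) := by
  cases b
  · have h : Equiv.symm T (T.entry false x) = Sum.inl x := Equiv.symm_apply_apply T (Sum.inl x)
    rw [coloring, h]
    rfl
  · have h : Equiv.symm T (T.entry true x) = Sum.inr x := Equiv.symm_apply_apply T (Sum.inr x)
    rw [coloring, h]
    rfl

theorem column_injective (T : Bitableau p) (b : Bool) (c : ℕ) :
    Function.Injective (column (T.entry b) c) := by
  intro r r' h
  have := T.entry_injective b h
  simpa [Fin.ext_iff] using this

theorem mem_fiber_coloring (T : Bitableau p) (b : Bool) (c : Fin (n + 1)) (i : Fin n) :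
    i ∈ T.coloring.fiber (b, c) ↔ ∃ r, column (T.entry b) c r = i := by
  rw [Coloring.mem_fiber]
  constructor
  · intro h
    obtain ⟨b', ⟨⟨r, c'⟩, hx⟩, rfl⟩ := T.exists_entry_eq i
    rw [coloring_entry, Prod.mk.injEq] at h
    obtain ⟨rfl, rfl⟩ := h
    exact ⟨⟨r, YoungDiagram.mem_iff_lt_colLen.1 ((YoungDiagram.mem_cells ..).1 hx)⟩, rfl⟩
  · rintro ⟨r, rfl⟩
    rw [column, coloring_entry]
    rfl

theorem card_fiber_coloring (T : Bitableau p) (b : Bool) (c : Fin (n + 1)) :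
    (T.coloring.fiber (b, c)).card = (p.diagram b).colLen c := by
  have h : T.coloring.fiber (b, c) = Finset.univ.image (column (T.entry b) c) := by
    ext i
    rw [mem_fiber_coloring]
    simp
  rw [h, Finset.card_image_of_injective _ (T.column_injective b c)]
  simp

end Bitableau

theorem card_filter_lt_colLen (p : Bipartition n) (b : Bool) (r : ℕ) :
    (Finset.univ.filter fun c : Fin (n + 1) => r < (p.diagram b).colLen c).card =
      (p.diagram b).rowLen r := by
  have h : ∀ c, r < (p.diagram b).colLen c ↔ c < (p.diagram b).rowLen r := fun c => by
    rw [← YoungDiagram.mem_iff_lt_colLen, YoungDiagram.mem_iff_lt_rowLen]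
  have hle : (p.diagram b).rowLen r ≤ n := by
    rw [YoungDiagram.rowLen_eq_card]
    exact (Finset.card_le_card (Finset.filter_subset _ _)).trans (p.card_diagram_le b)
  simp only [h]
  rw [Fin.card_filter_val_lt]
  omega

theorem Bitableau.rowSeq_coloring {p : Bipartition n} (T : Bitableau p) :
    T.coloring.rowSeq = p.rowSeq := by
  ext k
  simp only [Coloring.rowSeq, Bitableau.card_fiber_coloring, card_filter_lt_colLen, rowSeq]

variable (K : Type*) [Field K]

/-- The product over columns may run to `n + 1`, since the Vandermonde polynomial of an empty column
is 1. -/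
theorem associated_expand_tableauPoly {p : Bipartition n} (T : Bitableau p) (b : Bool) :
    Associated (expand 2 (tableauPoly K (T.entry b)))
      (∏ c : Fin (n + 1), delta K (T.coloring.fiber (b, c))) := by
  have hle : (p.diagram b).rowLen 0 ≤ n + 1 := by
    rw [YoungDiagram.rowLen_eq_card]
    exact ((Finset.card_le_card (Finset.filter_subset _ _)).trans (p.card_diagram_le b)).trans
      n.le_succ
  have hsub : tableauPoly K (T.entry b) =
      ∏ c ∈ Finset.range (n + 1), vandermonde K (column (T.entry b) c) := by
    refine Finset.prod_subset (Finset.range_subset_range.2 hle) fun c _ hc => ?_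
    have h0 : (p.diagram b).colLen c = 0 := by
      by_contra h
      refine hc (Finset.mem_range.2 ?_)
      rw [← YoungDiagram.mem_iff_lt_rowLen, YoungDiagram.mem_iff_lt_colLen]
      omega
    have : IsEmpty (Fin ((p.diagram b).colLen c)) := by rw [h0]; infer_instance
    rw [vandermonde, Finset.univ_eq_empty, Finset.prod_empty]
  rw [hsub, Finset.prod_range, map_prod]
  refine associated_prod_of_forall _ fun c _ => (associated_expand_vandermonde _).trans ?_
  exact associated_sqVandermonde_delta (T.column_injective b c) (T.mem_fiber_coloring b c)

theorem associated_poly_coloring {p : Bipartition n} (T : Bitableau p) :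
    Associated (Specht.poly K T) (T.coloring.poly K) := by
  have hmon : T.coloring.mon K = ∏ c : {c // c ∈ p.snd.cells}, X (T.right c) := by
    rw [Coloring.mon, ← Equiv.prod_comp T, Fintype.prod_sum_type, Finset.prod_eq_one, one_mul]
    · refine Finset.prod_congr rfl fun x _ => ?_
      have h : T.coloring (T.right x) = _ := T.coloring_entry true x
      change X (T.right x) ^ (T.coloring (T.right x)).1.toNat = _
      rw [h, Bool.toNat_true, pow_one]
    · intro x _
      have h : T.coloring (T.left x) = _ := T.coloring_entry false x
      change X (T.left x) ^ (T.coloring (T.left x)).1.toNat = _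
      rw [h, Bool.toNat_false, pow_zero]
  rw [Specht.poly, Coloring.poly, ← hmon, Fintype.prod_prod_type, Fintype.prod_bool,
    mul_comm (∏ c : Fin (n + 1), delta K (T.coloring.fiber (true, c)))]
  exact ((associated_expand_tableauPoly K T false).mul_mul
    (associated_expand_tableauPoly K T true)).mul_mul (Associated.refl _)

/-- Fill each column of the diagrams with its color class in increasing order. -/
theorem exists_coloring_eq {p : Bipartition n} {g : Coloring n}
    (hg : ∀ b c, (g.fiber (b, c)).card = (p.diagram b).colLen c) :
    ∃ T : Bitableau p, T.coloring = g := by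
  set e : (b : Bool) → {x // x ∈ (p.diagram b).cells} → Fin n := fun b x =>
    (g.fiber (b, Bitableau.columnIndex b x)).orderEmbOfFin (hg _ _)
      ⟨x.1.1, YoungDiagram.mem_iff_lt_colLen.1 ((YoungDiagram.mem_cells ..).1 x.2)⟩ with he
  have hge : ∀ b x, g (e b x) = (b, Bitableau.columnIndex b x) := fun b x =>
    Coloring.mem_fiber.1 (Finset.orderEmbOfFin_mem _ _ _)
  have hinj : ∀ b, Function.Injective (e b) := by
    rintro b ⟨⟨r, c⟩, hx⟩ ⟨⟨r', c'⟩, hx'⟩ h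
    have h1 := hge b ⟨(r, c), hx⟩
    rw [h, hge, Prod.mk.injEq] at h1
    obtain rfl : c' = c := congrArg Fin.val h1.2
    have h2 := (Finset.orderEmbOfFin _ _).injective h
    obtain rfl : r = r' := congrArg Fin.val h2
    rfl
  have hinj' : Function.Injective (Sum.elim (e false) (e true)) := by
    refine (hinj false).sumElim (hinj true) fun x y h => ?_
    have h1 := hge false x
    rw [h, hge] at h1
    simp at h1
  have hbij : Function.Bijective (Sum.elim (e false) (e true)) := by
    rw [Fintype.bijective_iff_injective_and_card]
    refine ⟨hinj', ?_⟩
    rw [Fintype.card_sum, Fintype.card_coe, Fintype.card_coe, Fintype.card_fin]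
    exact p.card_add_card
  obtain ⟨T, hT⟩ : ∃ T : Bitableau p, T = Equiv.ofBijective _ hbij := ⟨_, rfl⟩
  have hTe : ∀ b x, T.entry b x = e b x := by
    rintro (_ | _) x <;> rw [hT] <;> rfl
  refine ⟨T, funext fun i => ?_⟩
  obtain ⟨b, x, rfl⟩ := T.exists_entry_eq i
  rw [Bitableau.coloring_entry, hTe, hge]

/-- Equal row lengths mean that the columns agree up to a permutation within each diagram, and
relabelling columns does not change the polynomial. -/
theorem poly_mem_ideal_of_rowSeq_eq (p : Bipartition n) {g : Coloring n}
    (hg : g.rowSeq = p.rowSeq) : g.poly K ∈ Specht.ideal K p := by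
  have hσ : ∀ b, ∃ σ : Equiv.Perm (Fin (n + 1)), ∀ c,
      (p.diagram b).colLen (σ c) = (g.fiber (b, c)).card := by
    intro b
    refine exists_perm_of_card_filter_lt_eq (h := fun c : Fin (n + 1) => (p.diagram b).colLen c)
      fun r => ?_
    rw [card_filter_lt_colLen]
    have h := congrFun hg (2 * r + b.toNat)
    have h1 : (2 * r + b.toNat) / 2 = r := by cases b <;> simp; omega
    have h2 : decide ((2 * r + b.toNat) % 2 = 1) = b := by cases b <;> simp
    rwa [Coloring.rowSeq, rowSeq, h1, h2] at h
  choose σ hσ using hσ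
  obtain ⟨g', hg'⟩ : ∃ g' : Coloring n, ∀ i, g' i = ((g i).1, σ (g i).1 (g i).2) :=
    ⟨_, fun _ => rfl⟩
  have hfib : ∀ b c, g'.fiber (b, σ b c) = g.fiber (b, c) := by
    intro b c
    ext i
    rw [Coloring.mem_fiber, Coloring.mem_fiber, hg']
    rcases g i with ⟨b', c'⟩
    rw [Prod.mk.injEq, Prod.mk.injEq]
    refine and_congr_right fun h => ?_
    subst h
    exact (σ b').injective.eq_iff
  have hpoly : g'.poly K = g.poly K := by
    rw [Coloring.poly, Coloring.poly, Fintype.prod_prod_type, Fintype.prod_prod_type]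
    congr 1
    · refine Finset.prod_congr rfl fun b _ => ?_
      rw [← Equiv.prod_comp (σ b)]
      exact Finset.prod_congr rfl fun c _ => by rw [hfib]
    · rw [Coloring.mon, Coloring.mon]
      exact Finset.prod_congr rfl fun i _ => by rw [hg']
  have hcard : ∀ b c, (g'.fiber (b, c)).card = (p.diagram b).colLen c := by
    intro b c
    obtain ⟨c, rfl⟩ := (σ b).surjective c
    rw [hfib, hσ]
  obtain ⟨T, hT⟩ := exists_coloring_eq hcard
  rw [← hpoly, ← hT]
  exact Ideal.mem_of_dvd _ (associated_poly_coloring K T).dvd (Ideal.subset_span ⟨T, rfl⟩)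

theorem ideal_le_of_le [CharZero K] {p q : Bipartition n} (h : q ≤ p) :
    Specht.ideal K q ≤ Specht.ideal K p := by
  rw [Specht.ideal, Ideal.span_le]
  rintro _ ⟨T, rfl⟩
  refine Ideal.mem_of_dvd _ (associated_poly_coloring K T).symm.dvd ?_
  -- Any bitableau of shape `p` serves to transport the general properties of row lengths of
  -- colorings to `p.rowSeq`.
  obtain ⟨T₀⟩ := (inferInstance : Nonempty p.Bitableau)
  have hT₀ := T₀.rowSeq_coloring
  refine Coloring.poly_mem_of_dominates _ (p := p.rowSeq) ?_ ?_ ?_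
    (fun g hg => poly_mem_ideal_of_rowSeq_eq K p hg) _ ?_
  · exact hT₀ ▸ T₀.coloring.rowSeq_add_two_le
  · exact hT₀ ▸ fun k => T₀.coloring.rowSeq_eq_zero
  · exact hT₀ ▸ T₀.coloring.sum_range_rowSeq_eq le_rfl
  · rw [T.rowSeq_coloring]
    exact le_iff_sum_range_rowSeq_le.1 h

end Bipartition

/-! ### Points that separate the varieties. -/

namespace Specht

open MvPolynomial

variable {K : Type*} [Field K] {n : ℕ}

theorem eval_delta_ne_zero_iff {A : Finset (Fin n)} {z : Fin n → K} :
    eval z (delta K A) ≠ 0 ↔ Set.InjOn (fun i => z i ^ 2) A := by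
  have h : eval z (delta K A) =
      (Matrix.vandermonde fun i => z (A.orderEmbOfFin rfl i) ^ 2).det := by
    rw [delta, sqVandermonde, RingHom.map_det]
    congr 1
    ext i j
    simp [Matrix.vandermonde_apply]
  rw [h, Matrix.det_vandermonde_ne_zero_iff, ← Finset.range_orderEmbOfFin A rfl]
  constructor
  · rintro hinj _ ⟨i, rfl⟩ _ ⟨j, rfl⟩ hij
    rw [hinj hij]
  · exact fun hinj i j hij => (A.orderEmbOfFin rfl).injective (hinj ⟨i, rfl⟩ ⟨j, rfl⟩ hij)

namespace Coloring

theorem eval_poly_ne_zero_iff {g : Coloring n} {z : Fin n → K} :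
    eval z (g.poly K) ≠ 0 ↔
      (∀ c, Set.InjOn (fun i => z i ^ 2) (g.fiber c)) ∧ ∀ i, (g i).1 = true → z i ≠ 0 := by
  rw [poly, map_mul, mul_ne_zero_iff, map_prod, Finset.prod_ne_zero_iff, mon, map_prod,
    Finset.prod_ne_zero_iff]
  simp only [Finset.mem_univ, true_imp_iff, eval_delta_ne_zero_iff]
  refine and_congr_right fun _ => forall_congr' fun i => ?_
  cases (g i).1 <;> simp

/-- The number of smaller elements in the same column. -/
def rank (g : Coloring n) (i : Fin n) : ℕ := ((g.fiber (g i)).filter (· < i)).card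

theorem injOn_rank (g : Coloring n) (c : Bool × Fin (n + 1)) : Set.InjOn g.rank (g.fiber c) := by
  have key : ∀ i j, g i = g j → i < j → g.rank i < g.rank j := by
    intro i j hij hlt
    refine Finset.card_lt_card ?_
    rw [hij, Finset.ssubset_iff_of_subset]
    · exact ⟨i, by simp [hij, hlt], by simp⟩
    · intro l hl
      rw [Finset.mem_filter] at hl ⊢
      exact ⟨hl.1, hl.2.trans hlt⟩
  intro i hi j hj h
  have hij : g i = g j := (mem_fiber.1 hi).trans (mem_fiber.1 hj).symm
  rcases lt_trichotomy i j with hlt | rfl | hlt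
  · exact absurd h (key i j hij hlt).ne
  · rfl
  · exact absurd h (key j i hij.symm hlt).ne'

/-- Within a column the ranks are exactly 0, 1, …, height - 1, so `rank` plays the role of the row
index. -/
theorem card_filter_rank_lt (g : Coloring n) (c : Bool × Fin (n + 1)) (t : ℕ) :
    ((g.fiber c).filter fun i => g.rank i < t).card = min (g.fiber c).card t := by
  have himage : (g.fiber c).image g.rank = Finset.range (g.fiber c).card := by
    refine Finset.eq_of_subset_of_card_le (fun r hr => ?_) ?_
    · obtain ⟨i, hi, rfl⟩ := Finset.mem_image.1 hr
      rw [Finset.mem_range, rank, mem_fiber.1 hi]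
      refine Finset.card_lt_card ?_
      rw [Finset.ssubset_iff_of_subset (Finset.filter_subset _ _)]
      exact ⟨i, hi, by simp⟩
    · rw [Finset.card_image_of_injOn (g.injOn_rank c), Finset.card_range]
  rw [← Finset.card_image_of_injOn (f := g.rank) ((g.injOn_rank c).mono (by
    rw [Finset.coe_filter]; exact fun i hi => hi.1)), ← Finset.filter_image (p := (· < t)), himage]
  have : (Finset.range (g.fiber c).card).filter (· < t) =
      Finset.range (min (g.fiber c).card t) := by
    ext r; simp
  rw [this, Finset.card_range]

/-- A point at which the polynomial of `g` does not vanish, while the polynomials of all colorings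
with a smaller sum of the first `k` row lengths do. -/
theorem exists_eval_ne_zero [CharZero K] (g : Coloring n) (k : ℕ) :
    ∃ z : Fin n → K, eval z (g.poly K) ≠ 0 ∧ ∀ g' : Coloring n, eval z (g'.poly K) ≠ 0 →
      ∑ l ∈ Finset.range k, g.rowSeq l ≤ ∑ l ∈ Finset.range k, g'.rowSeq l := by
  -- For even `k` this is `rank + 1` everywhere; for odd `k` it is `rank` in the first diagram and
  -- `rank + 1` in the second. In both cases `w i < k / 2 + 1` selects exactly the first `k` rows,
  -- and the values in the second diagram are nonzero.
  set w : Fin n → ℕ := fun i => (2 * g.rank i + (g i).1.toNat + 2 - k % 2) / 2 with hw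
  have hsq : ∀ i j, ((w i : K)) ^ 2 = (w j : K) ^ 2 ↔ w i = w j := by
    intro i j
    rw [← Nat.cast_pow, ← Nat.cast_pow, Nat.cast_inj]
    exact Nat.pow_left_injective two_ne_zero |>.eq_iff
  refine ⟨fun i => w i, eval_poly_ne_zero_iff.2 ⟨fun c i hi j hj h => ?_, fun i hi => ?_⟩,
    fun g' hg' => ?_⟩
  · have h1 : w i = w j := (hsq i j).1 h
    have hi' := mem_fiber.1 hi
    have hj' := mem_fiber.1 hj
    refine g.injOn_rank c hi hj ?_
    simp only [hw, hi', hj'] at h1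
    omega
  · rw [Nat.cast_ne_zero, hw]
    simp only [hi, Bool.toNat_true]
    omega
  · obtain ⟨hinj, hne⟩ := eval_poly_ne_zero_iff.1 hg'
    have hsum : ∀ h : Coloring n, (Finset.univ.filter fun i => w i < k / 2 + 1).card =
        ∑ c, ((h.fiber c).filter fun i => w i < k / 2 + 1).card := by
      intro h
      rw [Finset.card_eq_sum_card_fiberwise (t := Finset.univ) (f := h)
        (fun _ _ => Finset.mem_coe.2 (Finset.mem_univ _))]
      refine Finset.sum_congr rfl fun c _ => ?_
      rw [fiber, Finset.filter_filter, Finset.filter_filter]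
      simp only [and_comm]
    have hg : ∑ c, ((g.fiber c).filter fun i => w i < k / 2 + 1).card =
        ∑ l ∈ Finset.range k, g.rowSeq l := by
      rw [sum_range_rowSeq]
      refine Finset.sum_congr rfl fun c _ => ?_
      rw [← card_filter_rank_lt]
      congr 1
      refine Finset.filter_congr fun i hi => ?_
      have hb := Bool.toNat_le c.1
      simp only [hw, mem_fiber.1 hi, cap]
      omega
    rw [← hg, ← hsum g, hsum g', sum_range_rowSeq]
    refine Finset.sum_le_sum fun c _ => le_min (Finset.card_le_card (Finset.filter_subset _ _)) ?_
    have hwinj : Set.InjOn w ((g'.fiber c).filter fun i => w i < k / 2 + 1) := by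
      intro i hi j hj h
      rw [Finset.coe_filter] at hi hj
      exact hinj c hi.1 hj.1 ((hsq i j).2 h)
    rw [← Finset.card_image_of_injOn hwinj]
    -- The small values available to a column: 0 is excluded in the second diagram because the
    -- variable must not vanish, and for even `k` because `w` never takes it. This leaves `cap c.1
    -- k` values.
    have hsub : ((g'.fiber c).filter fun i => w i < k / 2 + 1).image w ⊆
        Finset.Ico (if c.1 then 1 else 1 - k % 2) (k / 2 + 1) := by
      intro r hr
      obtain ⟨i, hi, rfl⟩ := Finset.mem_image.1 hr
      rw [Finset.mem_filter] at hi
      rw [Finset.mem_Ico]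
      refine ⟨?_, hi.2⟩
      split_ifs with hc
      · have h1 := hne i (by rw [mem_fiber.1 hi.1, hc])
        rw [Nat.cast_ne_zero] at h1
        omega
      · simp only [hw]
        omega
    refine (Finset.card_le_card hsub).trans ?_
    rw [Nat.card_Ico]
    rcases c with ⟨_ | _, c⟩ <;> simp [cap]
    omega

end Coloring

end Specht

/-! ### Inclusion of varieties and the equivalence. -/

namespace Bipartition

open MvPolynomial Specht

variable {n : ℕ} (K : Type*) [Field K]

theorem mem_variety_iff {p : Bipartition n} {z : Fin n → K} :
    z ∈ Specht.variety K p ↔ ∀ T : Bitableau p, eval z (T.coloring.poly K) = 0 := by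
  have key : ∀ T : Bitableau p, eval z (T.coloring.poly K) = 0 ↔ eval z (Specht.poly K T) = 0 :=
    fun T => ((associated_poly_coloring K T).map (eval z)).symm.eq_zero_iff
  simp only [key]
  constructor
  · exact fun h T => h _ (Ideal.subset_span ⟨T, rfl⟩)
  · intro h
    have hle : Specht.ideal K p ≤ RingHom.ker (eval z) := by
      rw [Specht.ideal, Ideal.span_le]
      rintro _ ⟨T, rfl⟩
      exact h T
    exact fun f hf => hle hf

/-- For each `k`, the separating point of a bitableau of shape `q` lies outside the variety of `q`,
hence outside that of `p`; so some polynomial of shape `p` is nonzero there, and the `k`-th prefix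
sums compare. -/
theorem le_of_variety_subset [CharZero K] {p q : Bipartition n}
    (h : Specht.variety K p ⊆ Specht.variety K q) : q ≤ p := by
  rw [le_iff_sum_range_rowSeq_le]
  intro k
  obtain ⟨T⟩ := (inferInstance : Nonempty q.Bitableau)
  obtain ⟨z, hz, hz'⟩ := T.coloring.exists_eval_ne_zero (K := K) k
  have hzp : z ∉ Specht.variety K p := fun hp => hz ((mem_variety_iff K).1 (h hp) T)
  rw [mem_variety_iff, not_forall] at hzp
  obtain ⟨T', hT'⟩ := hzp
  rw [← T.rowSeq_coloring, ← T'.rowSeq_coloring]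
  exact hz' _ hT'

end Bipartition

theorem mainTheorem1 (K : Type*) [Field K] [CharZero K] (n : ℕ) (p q : Bipartition n) :
    List.TFAE
      [q ≤ p,
       Specht.ideal K q ≤ Specht.ideal K p,
       Specht.variety K p ⊆ Specht.variety K q] := by
  tfae_have 1 → 2 := Bipartition.ideal_le_of_le K
  tfae_have 2 → 3 := fun h _ hz f hf => hz f (h hf)
  tfae_have 3 → 1 := Bipartition.le_of_variety_subset K
  tfae_finish
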